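/- **Setting.** Let $\Omega\subset\mathbb R^d$ ($d\ge 1$) be a bounded polytopic domain with Lipschitz boundary, let $A=(a_{ij})$ be a symmetric positive definite matrix function on $\overline\Omega$ with $a_{ij}\in W^{1,\infty}(\Omega)$ (taken as continuous functions on $\overline\Omega$), and let $0\le\varphi\in L^\infty(\Omega)$. Put $V=H^1_0(\Omega)$, $Lu=-\nabla\cdot(A\nabla u)+\varphi u$, $a(u,v)=\int_\Omega(A\nabla u\cdot\nabla v+\varphi uv)$, $\|v\|_a=\sqrt{a(v,v)}$, and let $(\cdot,\cdot)$ be the $L^2(\Omega)$ inner product. Let $K:L^2(\Omega)\to V$ be defined by $a(Kf,v)=(f,v)$ for all $v\in V$. Let $\hat\lambda^1$ be the smallest eigenvalue of $a(u,v)=\lambda(u,v)$ for all $v\in V$, let $M(\hat\lambda^1)=\{u\in V: a(u,v)=\hat\lambda^1(u,v)\ \forall v\in V\}$, and let $E:V\to M(\hat\lambda^1)$ be the $a$-orthogonal projection. For a conforming simplicial mesh $\mathcal T$ of $\overline\Omega$ and a fixed degree $m\ge1$, the finite element space over $\mathcal T$ consists of the continuous piecewise polynomials of degree at most $m$ vanishing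 on $\partial\Omega$. For a mesh $\mathcal T_k$ with space $V_k$, $R_k:V\to V_k$ denotes the $a$-orthogonal (Galerkin) projection. For $f\in L^2(\Omega)$, $v\in V_k$ and $T\in\mathcal T_k$ let $$\eta_k^2(f,v;T)=h_T^2\|f-Lv\|_{0,T}^2+\sum_{F\subset\partial T}h_F\|[[A\nabla v]]_F\cdot\nu_F\|_{0,F}^2,$$ where the sum is over the interior faces $F$ of $T$, $h_T$ is the diameter of $T$, and $h_F$ is the diameter of $F$ (with $h_T$ in its place if $d=1$). For $\mathcal M\subset\mathcal T_k$ let $\eta_k(f,v;\mathcal M)=\big(\sum_{T\in\mathcal M}\eta_k^2(f,v;T)\big)^{1/2}$. **Modules.** $\mathsf{ESOLVE}(W)$ returns a discrete eigenpair $(\mu,w)$, $w\in W$, $\|w\|_a=1$, $a(w,v)=\mu(w,v)$ for all $v\in W$, for the smallest discrete eigenvalue $\mu$ in $W$. $\mathsf{LSOLVE}(f,W)$ returns the $w\in W$ with $a(w,v)=(f,v)$ for all $v\in W$. $\mathsf{MARK}(\theta,f,v,\mathcal T_k)$ returns a minimal $\mathcal M\subset\mathcal T_k$ with $\eta_k(f,v;\mathcal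 M)\ge\theta\,\eta_k(f,v;\mathcal T_k)$. $\mathsf{REFINE}(\mathcal M,\mathcal T_k)$ returns a conforming refinement of $\mathcal T_k$ in which at least all elements of $\mathcal M$ are refined. **Adaptive Algorithm C.** Given $\theta_1,\theta_2\in(0,1)$ and a coarse conforming mesh $\mathcal T_H$ with finite element space $V_H$, let $\mathcal T_1$ be a conforming refinement of $\mathcal T_H$. Let $(\lambda_1,u_1)=\mathsf{ESOLVE}(V_1)$ and set $\bar f_2^{(0)}=\bar f_1=u_1$, $\bar u_1=u_1/\lambda_1$, $\eta_1=\eta_1(\bar f_1,\bar u_1;\mathcal T_1)$, $n_1=1$, $k=2$, $\ell=1$, $j=0$. Then iterate: 1. $\mathcal M_{k-1}=\mathsf{MARK}(\theta_1,\bar f_{k-1},\bar u_{k-1},\mathcal T_{k-1})$. 2. $\mathcal T_k=\mathsf{REFINE}(\mathcal M_{k-1},\mathcal T_{k-1})$, with finite element space $V_k$. 3. $\bar u_k^{(j)}=\mathsf{LSOLVE}(\bar f_k^{(j)},V_k)$, $u_k^{(j)}=\bar u_k^{(j)}/\|\bar u_k^{(j)}\|_a$, $\lambda_k^{(j)}=a(u_k^{(j)},u_k^{(j)})/(u_k^{(j)},u_k^{(j)})$.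 4. Compute $\eta:=\eta_k(\bar f_k^{(j)},\bar u_k^{(j)};\mathcal T_k)$. 5. If $\eta\le\theta_2^{j+1}\eta_\ell$, solve $(\tilde\lambda_k^{(j)},\tilde u_k^{(j)})=\mathsf{ESOLVE}(V_H+\mathrm{span}\{u_k^{(j)}\})$, set $\bar f_k^{(j+1)}=\tilde u_k^{(j)}$, increase $j$ by one and go to 3. Otherwise set $\bar f_k=\bar f_k^{(j)}$, $\bar u_k=\bar u_k^{(j)}$, $u_k=u_k^{(j)}$, $\lambda_k=\lambda_k^{(j)}$. 6. If $j>0$, solve $(\tilde\lambda_k,\tilde u_k)=\mathsf{ESOLVE}(V_H+\mathrm{span}\{u_k\})$, set $\bar f_{k+1}^{(0)}=\tilde u_k$, $\eta_{\ell+1}=\eta$, $n_{\ell+1}=k$, increase $\ell$ by one and set $j=0$. If $j=0$, set $\bar f_{k+1}^{(0)}=u_k$. 7. Increase $k$ by one and go to 1. **Theorem.** Let $u_k^{(j)}$ and $u_k$ be produced by Adaptive Algorithm C, and put $$w_k^{(j)}=K\left(\frac{\bar f_k^{(j)}}{\|K\bar f_k^{(j)}\|_a}\right),\qquad w_k=K\left(\frac{\bar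 f_k}{\|K\bar f_k\|_a}\right).$$ Then, for all $k$ and $j$ that occur in a run of the algorithm, $$\|u_k^{(j)}-Eu_k^{(j)}\|_a\le\|(I-R_k)w_k^{(j)}\|_a+\|w_k^{(j)}-Ew_k^{(j)}\|_a,$$ $$\|u_k-Eu_k\|_a\le\|(I-R_k)w_k\|_a+\|w_k-Ew_k\|_a.$$ -/

import Mathlib

open MeasureTheory Set Filter Topology
open scoped ContDiff ENNReal

noncomputable section

namespace AFEM

/-- Points of `ℝ^d` with the Euclidean norm. -/
abbrev Pt (d : ℕ) := EuclideanSpace ℝ (Fin d)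

/-! ### Function spaces -/

/-- Test functions `C_c^∞(Ω)`. -/
def IsTestFunction {d : ℕ} (Ω : Set (Pt d)) (ψ : Pt d → ℝ) : Prop :=
  ContDiff ℝ ∞ ψ ∧ HasCompactSupport ψ ∧ tsupport ψ ⊆ Ω

/-- The `i`-th classical partial derivative. -/
def partialDeriv {d : ℕ} (i : Fin d) (ψ : Pt d → ℝ) (x : Pt d) : ℝ :=
  fderiv ℝ ψ x (EuclideanSpace.single i 1)

/-- `g` is the weak `i`-th partial derivative of `f` in `Ω`. -/
def IsWeakPartial {d : ℕ} (Ω : Set (Pt d)) (i : Fin d) (f g : Pt d → ℝ) : Prop :=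
  ∀ ψ : Pt d → ℝ, IsTestFunction Ω ψ →
    ∫ x in Ω, f x * partialDeriv i ψ x = -∫ x in Ω, g x * ψ x

/-- `f ∈ W^{1,∞}(Ω)`. -/
def MemW1Infty {d : ℕ} (Ω : Set (Pt d)) (f : Pt d → ℝ) : Prop :=
  MemLp f ∞ (volume.restrict Ω) ∧
    ∀ i : Fin d, ∃ g : Pt d → ℝ, MemLp g ∞ (volume.restrict Ω) ∧ IsWeakPartial Ω i f g

open Classical in
/-- The weak `i`-th partial derivative of a function of class `W^{1,∞}(Ω)`
(unique up to equality almost everywhere in `Ω`). -/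
def weakPartial {d : ℕ} (Ω : Set (Pt d)) (i : Fin d) (f : Pt d → ℝ) : Pt d → ℝ :=
  if h : ∃ g : Pt d → ℝ, MemLp g ∞ (volume.restrict Ω) ∧ IsWeakPartial Ω i f g then h.choose else 0

/-- `L²(Ω)`. -/
abbrev L2 {d : ℕ} (Ω : Set (Pt d)) := Lp ℝ 2 (volume.restrict Ω)

/-- The Hilbert space `L²(Ω) × L²(Ω; ℝ^d)`, in which `H¹(Ω)` is the space of the pairs `(v, ∇v)`;
its norm restricted to such pairs is the `H¹` norm. -/
abbrev GraphSpace {d : ℕ} (Ω : Set (Pt d)) :=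
  WithLp 2 (L2 Ω × Lp (Pt d) 2 (volume.restrict Ω))

/-- The pairs `(ψ, ∇ψ)` with `ψ ∈ C_c^∞(Ω)`. -/
def testPairs {d : ℕ} (Ω : Set (Pt d)) : Submodule ℝ (GraphSpace Ω) where
  carrier := {z | ∃ ψ : Pt d → ℝ, IsTestFunction Ω ψ ∧
    z.fst =ᵐ[volume.restrict Ω] ψ ∧ z.snd =ᵐ[volume.restrict Ω] gradient ψ}
  zero_mem' := by
    refine ⟨fun _ => 0, ⟨contDiff_const, HasCompactSupport.zero, by simp [tsupport]⟩,
      Lp.coeFn_zero _ _ _, ?_⟩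
    have h : gradient (fun _ : Pt d => (0 : ℝ)) = 0 := by ext1 x; simp [gradient]
    rw [h]
    exact Lp.coeFn_zero _ _ _
  add_mem' := by
    rintro y z ⟨ψ, ⟨h1, h2, h3⟩, h4, h5⟩ ⟨χ, ⟨g1, g2, g3⟩, g4, g5⟩
    refine ⟨ψ + χ, ⟨h1.add g1, h2.add g2, (tsupport_add ψ χ).trans (union_subset h3 g3)⟩,
      (Lp.coeFn_add _ _).trans (h4.add g4), ?_⟩
    have h : gradient (ψ + χ) = gradient ψ + gradient χ := by
      ext1 x
      simp only [gradient, Pi.add_apply]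
      rw [fderiv_add (h1.differentiable (by simp) x) (g1.differentiable (by simp) x), map_add]
    rw [h]
    exact (Lp.coeFn_add _ _).trans (h5.add g5)
  smul_mem' := by
    rintro c z ⟨ψ, ⟨h1, h2, h3⟩, h4, h5⟩
    refine ⟨c • ψ, ⟨h1.const_smul c, h2.smul_left (f := fun _ => c),
      (tsupport_smul_subset_right (fun _ => c) ψ).trans h3⟩,
      (Lp.coeFn_smul _ _).trans (h4.const_smul c), ?_⟩
    have h : gradient (c • ψ) = c • gradient ψ := by
      ext1 x
      simp only [gradient, Pi.smul_apply]
      rw [fderiv_const_smul (h1.differentiable (by simp) x), map_smul]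
    rw [h]
    exact (Lp.coeFn_smul _ _).trans (h5.const_smul c)

/-- The pairs `(v, ∇v)` with `v ∈ H¹₀(Ω)`, where `H¹₀(Ω)` is the closure of `C_c^∞(Ω)` in the
`H¹` norm (for a bounded Lipschitz domain: the functions of `H¹(Ω)` with zero trace). -/
def graphH10 {d : ℕ} (Ω : Set (Pt d)) : Submodule ℝ (GraphSpace Ω) :=
  (testPairs Ω).topologicalClosure

/-- The Hilbert space `H¹₀(Ω)` with the `H¹` inner product. -/
def H10 {d : ℕ} (Ω : Set (Pt d)) : Type := graphH10 Ω

instance {d : ℕ} (Ω : Set (Pt d)) : NormedAddCommGroup (H10 Ω) :=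
  inferInstanceAs (NormedAddCommGroup (graphH10 Ω))

instance {d : ℕ} (Ω : Set (Pt d)) : InnerProductSpace ℝ (H10 Ω) :=
  inferInstanceAs (InnerProductSpace ℝ (graphH10 Ω))

instance {d : ℕ} (Ω : Set (Pt d)) : CompleteSpace (H10 Ω) :=
  (testPairs Ω).isClosed_topologicalClosure.completeSpace_coe

/-- The embedding `H¹₀(Ω) → L²(Ω)`. -/
def embL2 {d : ℕ} (Ω : Set (Pt d)) : H10 Ω →L[ℝ] L2 Ω :=
  (WithLp.fstL 2 ℝ (L2 Ω) (Lp (Pt d) 2 (volume.restrict Ω))).comp (graphH10 Ω).subtypeL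

/-- The weak gradient of an element of `H¹₀(Ω)`. -/
def weakGrad {d : ℕ} (Ω : Set (Pt d)) : H10 Ω →L[ℝ] Lp (Pt d) 2 (volume.restrict Ω) :=
  (WithLp.sndL 2 ℝ (L2 Ω) (Lp (Pt d) 2 (volume.restrict Ω))).comp (graphH10 Ω).subtypeL

theorem norm_sq_eq {d : ℕ} {Ω : Set (Pt d)} (v : H10 Ω) :
    ‖v‖ ^ 2 = ‖embL2 Ω v‖ ^ 2 + ‖weakGrad Ω v‖ ^ 2 := by
  exact WithLp.prod_norm_sq_eq_of_L2 (show graphH10 Ω from v).1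

/-- Integration by parts for two test functions. -/
theorem integral_test {d : ℕ} {Ω : Set (Pt d)} {χ ψ : Pt d → ℝ} (hχ : IsTestFunction Ω χ)
    (hψ : ContDiff ℝ ∞ ψ) (i : Fin d) :
    ∫ x in Ω, χ x * partialDeriv i ψ x = -∫ x in Ω, partialDeriv i χ x * ψ x := by
  obtain ⟨h1, h2, h3⟩ := hχ
  have hd : ∀ {f : Pt d → ℝ}, ContDiff ℝ ∞ f → Continuous (fun x => partialDeriv i f x) := by
    intro f hf
    exact (hf.continuous_fderiv (by simp)).clm_apply continuous_const
  have hs : HasCompactSupport (fun x => partialDeriv i χ x) :=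
    (h2.fderiv (𝕜 := ℝ)).comp_left (g := fun L : Pt d →L[ℝ] ℝ => L (EuclideanSpace.single i 1))
      (by simp)
  have hz : ∀ x ∉ Ω, χ x = 0 := fun x hx =>
    image_eq_zero_of_notMem_tsupport fun h => hx (h3 h)
  have hz' : ∀ x ∉ Ω, partialDeriv i χ x = 0 := fun x hx => by
    have : fderiv ℝ χ x = 0 :=
      image_eq_zero_of_notMem_tsupport fun h => hx (h3 (tsupport_fderiv_subset ℝ h))
    simp [partialDeriv, this]
  rw [setIntegral_eq_integral_of_forall_compl_eq_zero (fun x hx => by simp [hz x hx]),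
    setIntegral_eq_integral_of_forall_compl_eq_zero (fun x hx => by simp [hz' x hx])]
  refine integral_mul_fderiv_eq_neg_fderiv_mul_of_integrable ?_ ?_ ?_ ?_ ?_
  · exact ((hd h1).mul hψ.continuous).integrable_of_hasCompactSupport hs.mul_right
  · exact (h1.continuous.mul (hd hψ)).integrable_of_hasCompactSupport h2.mul_right
  · exact (h1.continuous.mul hψ.continuous).integrable_of_hasCompactSupport h2.mul_right
  · exact fun x _ => h1.differentiable (by simp) x
  · exact fun x _ => hψ.differentiable (by simp) x

/-- The gradient component of an element of `H¹₀(Ω)` is the weak gradient. -/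
theorem isWeakPartial_weakGrad {d : ℕ} {Ω : Set (Pt d)} (v : H10 Ω) (i : Fin d) :
    IsWeakPartial Ω i (embL2 Ω v) (fun x => weakGrad Ω v x i) := by
  rintro ψ ⟨h1, h2, h3⟩
  have hd : Continuous (fun x => partialDeriv i ψ x) :=
    (h1.continuous_fderiv (by simp)).clm_apply continuous_const
  have hs : HasCompactSupport (fun x => partialDeriv i ψ x) :=
    (h2.fderiv (𝕜 := ℝ)).comp_left (g := fun L : Pt d →L[ℝ] ℝ => L (EuclideanSpace.single i 1))
      (by simp)
  have m1 : MemLp (fun x => partialDeriv i ψ x) 2 (volume.restrict Ω) :=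
    hd.memLp_of_hasCompactSupport hs
  have m2 : MemLp (fun x => EuclideanSpace.single i (ψ x)) 2 (volume.restrict Ω) := by
    refine Continuous.memLp_of_hasCompactSupport ?_ ?_
    · have : Continuous (fun t : ℝ => (EuclideanSpace.single i t : Pt d)) := by
        refine (PiLp.continuous_toLp 2 _).comp (continuous_pi fun j => ?_)
        by_cases h : j = i
        · subst h; simpa using continuous_id'
        · simp [h, continuous_const]
      exact this.comp h1.continuous
    · exact h2.comp_left (g := fun t : ℝ => (EuclideanSpace.single i t : Pt d)) (by simp)
  have e1 : ∀ w : L2 Ω, inner ℝ (m1.toLp _) w = ∫ x in Ω, w x * partialDeriv i ψ x := by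
    intro w
    rw [L2.inner_def]
    refine integral_congr_ae ?_
    filter_upwards [m1.coeFn_toLp] with x hx
    rw [hx]; simp
  have e2 : ∀ w : Lp (Pt d) 2 (volume.restrict Ω),
      inner ℝ (m2.toLp _) w = ∫ x in Ω, w x i * ψ x := by
    intro w
    rw [L2.inner_def]
    refine integral_congr_ae ?_
    filter_upwards [m2.coeFn_toLp] with x hx
    rw [hx, EuclideanSpace.inner_single_left]; simp [mul_comm]
  have hcl : IsClosed {z : GraphSpace Ω |
      inner ℝ (m1.toLp _) z.fst = -inner ℝ (m2.toLp _) z.snd} :=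
    isClosed_eq (continuous_const.inner
        ((WithLp.fstL 2 ℝ (L2 Ω) (Lp (Pt d) 2 (volume.restrict Ω))).continuous))
      (continuous_const.inner
        ((WithLp.sndL 2 ℝ (L2 Ω) (Lp (Pt d) 2 (volume.restrict Ω))).continuous)).neg
  have hsub : (testPairs Ω : Set (GraphSpace Ω)) ⊆ {z : GraphSpace Ω |
      inner ℝ (m1.toLp _) z.fst = -inner ℝ (m2.toLp _) z.snd} := by
    rintro z ⟨χ, hχ, h4, h5⟩
    simp only [mem_ofPred_eq]
    rw [e1, e2]
    have h6 := integral_test hχ h1 i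
    have h7 : ∫ x in Ω, z.fst x * partialDeriv i ψ x = ∫ x in Ω, χ x * partialDeriv i ψ x :=
      integral_congr_ae (by filter_upwards [h4] with x hx; rw [hx])
    have h8 : ∫ x in Ω, z.snd x i * ψ x = ∫ x in Ω, partialDeriv i χ x * ψ x := by
      refine integral_congr_ae ?_
      filter_upwards [h5] with x hx
      have : gradient χ x i = partialDeriv i χ x := by
        have h9 : inner ℝ (gradient χ x) (EuclideanSpace.single i (1 : ℝ)) = partialDeriv i χ x := by
          rw [gradient, InnerProductSpace.toDual_symm_apply, partialDeriv]
        rw [← h9, EuclideanSpace.inner_single_right]; simp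
      rw [hx, this]
    rw [h7, h8, h6]
  have := closure_minimal hsub hcl (show graphH10 Ω from v).2
  simp only [mem_ofPred_eq] at this
  rw [e1, e2] at this
  exact this

/-- An element of `H¹₀(Ω)` is determined by its function component. -/
theorem embL2_injective {d : ℕ} {Ω : Set (Pt d)} (hΩ : IsOpen Ω) :
    Function.Injective (embL2 Ω) := by
  have key : ∀ (v : H10 Ω) (ψ : Pt d → ℝ), IsTestFunction Ω ψ → ∀ i : Fin d,
      ∫ x in Ω, embL2 Ω v x * partialDeriv i ψ x = -∫ x in Ω, weakGrad Ω v x i * ψ x :=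
    fun v ψ hψ i => isWeakPartial_weakGrad v i ψ hψ
  rw [injective_iff_map_eq_zero]
  intro v hv
  have h0 : weakGrad Ω v = 0 := by
    rw [Lp.eq_zero_iff_ae_eq_zero]
    have hcomp : ∀ i : Fin d, ∀ᵐ x ∂(volume.restrict Ω), weakGrad Ω v x i = 0 := by
      intro i
      have hmem : MemLp (fun x => weakGrad Ω v x i) 2 (volume.restrict Ω) := by
        exact (EuclideanSpace.proj i : Pt d →L[ℝ] ℝ).comp_memLp' (Lp.memLp _)
      have hloc : LocallyIntegrableOn (fun x => weakGrad Ω v x i) Ω volume :=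
        locallyIntegrableOn_of_locallyIntegrable_restrict (hmem.locallyIntegrable (by norm_num))
      have := hΩ.ae_eq_zero_of_integral_contDiff_smul_eq_zero hloc (fun ψ h1 h2 h3 => by
        have h4 := key v ψ ⟨h1, h2, h3⟩ i
        have h5 : ∫ x in Ω, embL2 Ω v x * partialDeriv i ψ x = 0 := by
          rw [hv]
          refine integral_eq_zero_of_ae ?_
          filter_upwards [Lp.coeFn_zero ℝ 2 (volume.restrict Ω)] with x hx
          rw [hx]; simp
        rw [h5, eq_comm, neg_eq_zero] at h4
        rw [← h4, ← setIntegral_eq_integral_of_forall_compl_eq_zero (s := Ω)]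
        · simp [mul_comm]
        · intro x hx
          have : ψ x = 0 := image_eq_zero_of_notMem_tsupport fun h => hx (h3 h)
          simp [this])
      rw [ae_restrict_iff' hΩ.measurableSet]
      exact this
    filter_upwards [ae_all_iff.2 hcomp] with x hx
    ext i
    exact hx i
  have : ‖v‖ ^ 2 = 0 := by rw [norm_sq_eq, hv, h0]; simp
  simpa using this

/-- Poincare inequality. -/
theorem poincare {d : ℕ} {Ω : Set (Pt d)} (hd : 0 < d) (hΩ : IsOpen Ω) (hb : Bornology.IsBounded Ω) :
    ∃ C : ℝ, 0 ≤ C ∧ ∀ v : H10 Ω, ‖embL2 Ω v‖ ^ 2 ≤ C * ‖weakGrad Ω v‖ ^ 2 := by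
  obtain ⟨R, hR⟩ := hb.exists_norm_le
  refine ⟨4 * R ^ 2, by positivity, ?_⟩
  have key : ∀ z ∈ testPairs Ω, ‖z.fst‖ ^ 2 ≤ 4 * R ^ 2 * ‖z.snd‖ ^ 2 := by
    rintro z ⟨ψ, ⟨h1, h2, h3⟩, h4, h5⟩
    set i : Fin d := ⟨0, hd⟩
    have hz : ∀ x ∉ Ω, ψ x = 0 := fun x hx =>
      image_eq_zero_of_notMem_tsupport fun h => hx (h3 h)
    have hdc : Continuous (fun x => partialDeriv i ψ x) :=
      (h1.continuous_fderiv (by simp)).clm_apply continuous_const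
    have hgr : ∀ x, |partialDeriv i ψ x| ≤ ‖gradient ψ x‖ := by
      intro x
      have h9 : inner ℝ (gradient ψ x) (EuclideanSpace.single i (1 : ℝ)) = partialDeriv i ψ x := by
        rw [gradient, InnerProductSpace.toDual_symm_apply, partialDeriv]
      rw [← h9]
      simpa using abs_real_inner_le_norm (gradient ψ x) (EuclideanSpace.single i (1 : ℝ))
    have hgm : MemLp (gradient ψ) 2 (volume.restrict Ω) :=
      (memLp_congr_ae h5).1 (Lp.memLp z.snd)
    have n1 : ‖z.fst‖ ^ 2 = ∫ x in Ω, ψ x ^ 2 := by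
      rw [← real_inner_self_eq_norm_sq, L2.inner_def]
      refine integral_congr_ae ?_
      filter_upwards [h4] with x hx
      rw [hx]; simp [sq]
    have n2 : ‖z.snd‖ ^ 2 = ∫ x in Ω, ‖gradient ψ x‖ ^ 2 := by
      rw [← real_inner_self_eq_norm_sq, L2.inner_def]
      refine integral_congr_ae ?_
      filter_upwards [h5] with x hx
      rw [hx, real_inner_self_eq_norm_sq]
    have iψ : Integrable (fun x => ψ x ^ 2) (volume.restrict Ω) := by
      refine Continuous.integrable_of_hasCompactSupport (h1.continuous.pow 2) ?_
      exact h2.comp_left (g := fun t : ℝ => t ^ 2) (by simp)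
    have ig : Integrable (fun x => ‖gradient ψ x‖ ^ 2) (volume.restrict Ω) := hgm.integrable_norm_pow (by norm_num)
    have hcoord : ContDiff ℝ ∞ (fun x : Pt d => x i) :=
      (EuclideanSpace.proj i : Pt d →L[ℝ] ℝ).contDiff
    have hsq : IsTestFunction Ω (fun x => ψ x ^ 2) := by
      refine ⟨h1.pow 2, h2.comp_left (g := fun t : ℝ => t ^ 2) (by simp), ?_⟩
      refine subset_trans (closure_mono ?_) h3
      intro x hx
      simp only [Function.mem_support] at hx ⊢
      exact fun h => hx (by simp [h])
    have hibp := integral_test hsq hcoord i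
    have hone : ∀ x : Pt d, partialDeriv i (fun x : Pt d => x i) x = 1 := by
      intro x
      have : fderiv ℝ (fun x : Pt d => x i) x =
          (EuclideanSpace.proj i : Pt d →L[ℝ] ℝ) :=
        (EuclideanSpace.proj i : Pt d →L[ℝ] ℝ).fderiv
      rw [partialDeriv, this]; simp
    have hder : ∀ x, partialDeriv i (fun x => ψ x ^ 2) x = 2 * ψ x * partialDeriv i ψ x := by
      intro x
      have := ((h1.differentiable (by simp) x).hasFDerivAt.pow 2).fderiv
      simp only [partialDeriv]
      rw [this]; simp
    simp only [hone, mul_one, hder] at hibp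
    have hmain : ∫ x in Ω, ψ x ^ 2 ≤
        ∫ x in Ω, ((1 / 2) * ψ x ^ 2 + 2 * R ^ 2 * ‖gradient ψ x‖ ^ 2) := by
      rw [hibp, ← integral_neg]
      refine integral_mono_ae ?_ ((iψ.const_mul _).add (ig.const_mul _)) ?_
      · refine (Continuous.integrable_of_hasCompactSupport (by fun_prop) ?_).neg
        exact (h2.mul_left (f := fun _ => (2 : ℝ))).mul_right.mul_right
      · filter_upwards [ae_restrict_mem hΩ.measurableSet] with x hx
        have hxi : |x i| ≤ R := (PiLp.norm_apply_le x i).trans (hR x hx)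
        have hR0 : 0 ≤ R := (abs_nonneg _).trans hxi
        have hprod : |partialDeriv i ψ x * x i| ≤ ‖gradient ψ x‖ * R := by
          rw [abs_mul]
          exact mul_le_mul (hgr x) hxi (abs_nonneg _) (norm_nonneg _)
        have hsqle : (partialDeriv i ψ x * x i) ^ 2 ≤ (‖gradient ψ x‖ * R) ^ 2 :=
          sq_le_sq' (by linarith [neg_abs_le (partialDeriv i ψ x * x i)])
            ((le_abs_self _).trans hprod)
        nlinarith [sq_nonneg (ψ x + 2 * (partialDeriv i ψ x * x i))]
    rw [integral_add (iψ.const_mul _) (ig.const_mul _), integral_const_mul, integral_const_mul]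
      at hmain
    rw [n1, n2]
    linarith
  rintro ⟨v, hv⟩
  have hcl : IsClosed {z : GraphSpace Ω | ‖z.fst‖ ^ 2 ≤ 4 * R ^ 2 * ‖z.snd‖ ^ 2} :=
    isClosed_le (((WithLp.fstL 2 ℝ (L2 Ω) (Lp (Pt d) 2 (volume.restrict Ω))).continuous).norm.pow 2)
      (continuous_const.mul
        (((WithLp.sndL 2 ℝ (L2 Ω) (Lp (Pt d) 2 (volume.restrict Ω))).continuous).norm.pow 2))
  exact closure_minimal key hcl hv

/-! ### The elliptic problem -/

/-- The number `(M ξ) · ζ`. -/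
def matForm {d : ℕ} (M : Matrix (Fin d) (Fin d) ℝ) (ξ ζ : Pt d) : ℝ :=
  ∑ i, ∑ j, M i j * ξ j * ζ i

/-- The data of the eigenvalue problem `-∇·(A∇u) + φu = λu` in `Ω`, `u = 0` on `∂Ω`. -/
structure EllipticProblem (d : ℕ) where
  /-- a bounded polytopic domain of `ℝ^d`, `d ≥ 1`, with Lipschitz boundary -/
  Ω : Set (Pt d)
  dim_pos : 0 < d
  isOpen : IsOpen Ω
  isConnected : IsConnected Ω
  isBounded : Bornology.IsBounded Ω
  polytopic : ∃ S : Finset (Finset (Pt d)), closure Ω = ⋃ T ∈ S, convexHull ℝ (T : Set (Pt d))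
  lipschitz_boundary : ∀ x ∈ frontier Ω, ∃ e : Pt d, ‖e‖ = 1 ∧
    ∃ (K : NNReal) (g : Pt d → ℝ), LipschitzWith K g ∧ ∃ r > 0, ∀ y ∈ Metric.ball x r,
      (y ∈ Ω ↔ g (y - inner ℝ e y • e) < inner ℝ e y)
  /-- the diffusion matrix, through its continuous representative on the closure of `Ω` -/
  A : Pt d → Matrix (Fin d) (Fin d) ℝ
  A_mem : ∀ i j, MemW1Infty Ω (fun x => A x i j)
  A_continuousOn : ∀ i j, ContinuousOn (fun x => A x i j) (closure Ω)
  A_posDef : ∀ x ∈ closure Ω, (A x).PosDef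
  φ : Pt d → ℝ
  φ_mem : MemLp φ ∞ (volume.restrict Ω)
  φ_nonneg : ∀ᵐ x ∂(volume.restrict Ω), 0 ≤ φ x

namespace EllipticProblem

variable {d : ℕ} (P : EllipticProblem d)

/-- `V = H¹₀(Ω)`. -/
abbrev V := H10 P.Ω

/-- The integrand of the bilinear form `a(u,v)`. -/
def energyDensity (u v : P.V) (x : Pt d) : ℝ :=
  matForm (P.A x) (weakGrad P.Ω u x) (weakGrad P.Ω v x) + P.φ x * embL2 P.Ω u x * embL2 P.Ω v x

/-- `a(u,v) = ∫_Ω (A∇u·∇v + φuv)`. -/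
def a (u v : P.V) : ℝ := ∫ x in P.Ω, P.energyDensity u v x

/-- The energy norm `‖u‖_a = √a(u,u)`. -/
def energyNorm (u : P.V) : ℝ := Real.sqrt (P.a u u)

theorem exists_uniform_bound : ∃ C : ℝ, 0 ≤ C ∧ ∀ᵐ x ∂(volume.restrict P.Ω),
    (∀ i j, |P.A x i j| ≤ C) ∧ |P.φ x| ≤ C := by
  have h : ∀ f : Pt d → ℝ, MemLp f ∞ (volume.restrict P.Ω) →
      ∃ C : ℝ, 0 ≤ C ∧ ∀ᵐ x ∂(volume.restrict P.Ω), |f x| ≤ C := by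
    intro f hf
    refine ⟨(eLpNormEssSup f (volume.restrict P.Ω)).toReal, ENNReal.toReal_nonneg, ?_⟩
    have hlt : eLpNormEssSup f (volume.restrict P.Ω) < ⊤ := by
      rw [← eLpNorm_exponent_top]; exact hf.2
    filter_upwards [ae_le_eLpNormEssSup (f := f) (μ := volume.restrict P.Ω)] with x hx
    rw [← Real.norm_eq_abs, ← toReal_enorm]
    exact ENNReal.toReal_mono hlt.ne hx
  choose C hC hC' using fun i j => h _ (P.A_mem i j).1
  obtain ⟨D, hD, hD'⟩ := h _ P.φ_mem
  refine ⟨(∑ i, ∑ j, C i j) + D, add_nonneg (Finset.sum_nonneg fun i _ => Finset.sum_nonneg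
    fun j _ => hC i j) hD, ?_⟩
  filter_upwards [ae_all_iff.2 fun i => ae_all_iff.2 fun j => hC' i j, hD'] with x hx hx'
  have hs : 0 ≤ ∑ i, ∑ j, C i j :=
    Finset.sum_nonneg fun i _ => Finset.sum_nonneg fun j _ => hC i j
  refine ⟨fun i j => (hx i j).trans ?_, hx'.trans (by linarith)⟩
  have h1 : C i j ≤ ∑ j, C i j :=
    Finset.single_le_sum (f := fun j => C i j) (fun j _ => hC i j) (Finset.mem_univ j)
  have h2 : ∑ j, C i j ≤ ∑ i, ∑ j, C i j :=
    Finset.single_le_sum (f := fun i => ∑ j, C i j)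
      (fun i _ => Finset.sum_nonneg fun j _ => hC i j) (Finset.mem_univ i)
  linarith

theorem exists_uniform_elliptic : ∃ α : ℝ, 0 < α ∧ ∀ x ∈ P.Ω, ∀ ξ : Pt d,
    α * ‖ξ‖ ^ 2 ≤ matForm (P.A x) ξ ξ := by
  set S : Set (Pt d × Pt d) := closure P.Ω ×ˢ Metric.sphere 0 1 with hS
  have hpos : ∀ x ∈ closure P.Ω, ∀ ξ : Pt d, ξ ≠ 0 → 0 < matForm (P.A x) ξ ξ := by
    intro x hx ξ hξ
    have h := (P.A_posDef x hx).dotProduct_mulVec_pos (x := ξ.ofLp) (by simpa using hξ)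
    have h' : star ξ.ofLp ⬝ᵥ (P.A x).mulVec ξ.ofLp = matForm (P.A x) ξ ξ := by
      simp only [matForm, dotProduct, Matrix.mulVec, Finset.mul_sum]
      refine Finset.sum_congr rfl fun i _ => Finset.sum_congr rfl fun j _ => ?_
      simp; ring
    rwa [h'] at h
  have hK : IsCompact S := (P.isBounded.isCompact_closure).prod (isCompact_sphere 0 1)
  have hne : S.Nonempty := by
    obtain ⟨x, hx⟩ := P.isConnected.nonempty
    exact ⟨(x, EuclideanSpace.single ⟨0, P.dim_pos⟩ 1), subset_closure hx, by simp⟩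
  have hcont : ContinuousOn (fun p : Pt d × Pt d => matForm (P.A p.1) p.2 p.2) S := by
    refine continuousOn_finsetSum _ fun i _ => continuousOn_finsetSum _ fun j _ => ?_
    refine (ContinuousOn.mul ?_ (by fun_prop)).mul (by fun_prop)
    exact (P.A_continuousOn i j).comp continuousOn_fst fun p hp => hp.1
  obtain ⟨p, hp, hmin⟩ := hK.exists_isMinOn hne hcont
  have hp2 : p.2 ≠ 0 := by
    have : ‖p.2‖ = 1 := by simpa using hp.2
    intro h0; rw [h0] at this; simp at this
  refine ⟨_, hpos p.1 hp.1 p.2 hp2, fun x hx ξ => ?_⟩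
  by_cases hξ : ξ = 0
  · simp [hξ, matForm]
  have hn : ‖ξ‖ ≠ 0 := by simpa using hξ
  have hmem : (x, ‖ξ‖⁻¹ • ξ) ∈ S := ⟨subset_closure hx, by simp [norm_smul, hn]⟩
  have h1 := hmin hmem
  have h2 : matForm (P.A x) (‖ξ‖⁻¹ • ξ) (‖ξ‖⁻¹ • ξ) = (‖ξ‖ ^ 2)⁻¹ * matForm (P.A x) ξ ξ := by
    simp only [matForm, Finset.mul_sum, PiLp.smul_apply, smul_eq_mul]
    refine Finset.sum_congr rfl fun i _ => Finset.sum_congr rfl fun j _ => ?_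
    rw [sq, mul_inv]; ring
  simp only [mem_ofPred_eq, h2] at h1
  rwa [inv_mul_eq_div, le_div_iff₀ (by positivity)] at h1

theorem integrable_energyDensity (u v : P.V) :
    Integrable (P.energyDensity u v) (volume.restrict P.Ω) := by
  have hcomp : ∀ (w : P.V) (i : Fin d),
      MemLp (fun x => weakGrad P.Ω w x i) 2 (volume.restrict P.Ω) := fun w i =>
    (EuclideanSpace.proj i : Pt d →L[ℝ] ℝ).comp_memLp' (Lp.memLp _)
  obtain ⟨C, -, hC⟩ := P.exists_uniform_bound
  have hbdd : ∀ (f g h : Pt d → ℝ), MemLp f ∞ (volume.restrict P.Ω) →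
      MemLp g 2 (volume.restrict P.Ω) → MemLp h 2 (volume.restrict P.Ω) →
      (∀ᵐ x ∂(volume.restrict P.Ω), |f x| ≤ C) →
      Integrable (fun x => f x * g x * h x) (volume.restrict P.Ω) := by
    intro f g h hf hg hh hb
    have h1 : Integrable (fun x => g x * h x) (volume.restrict P.Ω) := hg.integrable_mul hh
    have h2 := h1.bdd_mul (c := C) hf.1 hb
    simpa [mul_assoc] using h2
  refine Integrable.add ?_ ?_
  · refine integrable_finsetSum _ fun i _ => integrable_finsetSum _ fun j _ => ?_
    exact hbdd _ _ _ (P.A_mem i j).1 (hcomp u j) (hcomp v i) (hC.mono fun x hx => hx.1 i j)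
  · exact hbdd _ _ _ P.φ_mem (Lp.memLp _) (Lp.memLp _) (hC.mono fun x hx => hx.2)

theorem integral_norm_mul_norm_le {F : Type*} [NormedAddCommGroup F]
    {μ : Measure (Pt d)} (f g : Lp F 2 μ) :
    Integrable (fun x => ‖f x‖ * ‖g x‖) μ ∧ ∫ x, ‖f x‖ * ‖g x‖ ∂μ ≤ ‖f‖ * ‖g‖ := by
  have hf := (Lp.memLp f).norm
  have hg := (Lp.memLp g).norm
  refine ⟨hf.integrable_mul hg, ?_⟩
  have h1 : inner ℝ (hf.toLp _) (hg.toLp _) = ∫ x, ‖f x‖ * ‖g x‖ ∂μ := by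
    rw [L2.inner_def]
    refine integral_congr_ae ?_
    filter_upwards [hf.coeFn_toLp, hg.coeFn_toLp] with x hx hy
    rw [hx, hy]
    simp [mul_comm]
  have h2 : ‖hf.toLp _‖ = ‖f‖ := by rw [Lp.norm_toLp, eLpNorm_norm, Lp.norm_def]
  have h3 : ‖hg.toLp _‖ = ‖g‖ := by rw [Lp.norm_toLp, eLpNorm_norm, Lp.norm_def]
  rw [← h1, ← h2, ← h3]
  exact real_inner_le_norm _ _

theorem exists_bound : ∃ C : ℝ, ∀ u v : P.V, ‖P.a u v‖ ≤ C * ‖u‖ * ‖v‖ := by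
  obtain ⟨C, hC0, hC⟩ := P.exists_uniform_bound
  refine ⟨d * d * C + C, fun u v => ?_⟩
  obtain ⟨i1, b1⟩ := integral_norm_mul_norm_le (weakGrad P.Ω u) (weakGrad P.Ω v)
  obtain ⟨i2, b2⟩ := integral_norm_mul_norm_le (embL2 P.Ω u) (embL2 P.Ω v)
  have hle : ∀ w : P.V, ‖embL2 P.Ω w‖ ≤ ‖w‖ ∧ ‖weakGrad P.Ω w‖ ≤ ‖w‖ := by
    intro w
    have := norm_sq_eq w
    constructor <;> refine le_of_sq_le_sq ?_ (norm_nonneg _) <;>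
      nlinarith [sq_nonneg ‖embL2 P.Ω w‖, sq_nonneg ‖weakGrad P.Ω w‖]
  have hint : ‖P.a u v‖ ≤ ∫ x in P.Ω, (d * d * C * (‖weakGrad P.Ω u x‖ * ‖weakGrad P.Ω v x‖) +
      C * (‖embL2 P.Ω u x‖ * ‖embL2 P.Ω v x‖)) := by
    refine norm_integral_le_of_norm_le ((i1.const_mul _).add (i2.const_mul _)) ?_
    filter_upwards [hC] with x hx
    refine (norm_add_le _ _).trans (add_le_add ?_ ?_)
    · have : ∀ i ∈ Finset.univ, ∀ j ∈ Finset.univ,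
          ‖P.A x i j * weakGrad P.Ω u x j * weakGrad P.Ω v x i‖ ≤
            C * (‖weakGrad P.Ω u x‖ * ‖weakGrad P.Ω v x‖) := by
        intro i _ j _
        rw [norm_mul, norm_mul, mul_assoc]
        refine mul_le_mul (hx.1 i j) (mul_le_mul (PiLp.norm_apply_le _ j) (PiLp.norm_apply_le _ i)
          (norm_nonneg _) (norm_nonneg _)) (by positivity) hC0
      refine (norm_sum_le_of_le _ fun i hi => norm_sum_le_of_le _ (this i hi)).trans (le_of_eq ?_)
      simp only [Finset.sum_const, Finset.card_univ, Fintype.card_fin, nsmul_eq_mul]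
      ring
    · rw [norm_mul, norm_mul, mul_assoc]
      exact mul_le_mul_of_nonneg_right hx.2 (by positivity)
  rw [integral_add (i1.const_mul _) (i2.const_mul _), integral_const_mul, integral_const_mul]
    at hint
  have c1 : ‖weakGrad P.Ω u‖ * ‖weakGrad P.Ω v‖ ≤ ‖u‖ * ‖v‖ :=
    mul_le_mul (hle u).2 (hle v).2 (norm_nonneg _) (norm_nonneg _)
  have c2 : ‖embL2 P.Ω u‖ * ‖embL2 P.Ω v‖ ≤ ‖u‖ * ‖v‖ :=
    mul_le_mul (hle u).1 (hle v).1 (norm_nonneg _) (norm_nonneg _)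
  have e1 : d * d * C * ∫ x in P.Ω, ‖weakGrad P.Ω u x‖ * ‖weakGrad P.Ω v x‖ ≤
      d * d * C * (‖u‖ * ‖v‖) := mul_le_mul_of_nonneg_left (b1.trans c1) (by positivity)
  have e2 : C * ∫ x in P.Ω, ‖embL2 P.Ω u x‖ * ‖embL2 P.Ω v x‖ ≤ C * (‖u‖ * ‖v‖) :=
    mul_le_mul_of_nonneg_left (b2.trans c2) hC0
  nlinarith

theorem a_add_left (u u' v : P.V) : P.a (u + u') v = P.a u v + P.a u' v := by
  rw [a, a, a, ← integral_add (P.integrable_energyDensity u v) (P.integrable_energyDensity u' v)]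
  refine integral_congr_ae ?_
  have h1 := Lp.coeFn_add (weakGrad P.Ω u) (weakGrad P.Ω u')
  have h2 := Lp.coeFn_add (embL2 P.Ω u) (embL2 P.Ω u')
  rw [← map_add] at h1 h2
  filter_upwards [h1, h2] with x hx hy
  simp only [energyDensity, hx, hy, matForm, Pi.add_apply, PiLp.add_apply, mul_add, add_mul,
    Finset.sum_add_distrib]
  ring

theorem a_smul_left (c : ℝ) (u v : P.V) : P.a (c • u) v = c * P.a u v := by
  rw [a, a, ← integral_const_mul]
  refine integral_congr_ae ?_
  have h1 := Lp.coeFn_smul c (weakGrad P.Ω u)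
  have h2 := Lp.coeFn_smul c (embL2 P.Ω u)
  rw [← map_smul] at h1 h2
  filter_upwards [h1, h2] with x hx hy
  simp only [energyDensity, hx, hy, matForm, Pi.smul_apply, PiLp.smul_apply, smul_eq_mul, mul_add,
    Finset.mul_sum]
  congr 1
  · exact Finset.sum_congr rfl fun i _ => Finset.sum_congr rfl fun j _ => by ring
  · ring

theorem a_comm (u v : P.V) : P.a u v = P.a v u := by
  refine setIntegral_congr_fun P.isOpen.measurableSet fun x hx => ?_
  have hs : ∀ i j, P.A x i j = P.A x j i := fun i j => by
    have := (P.A_posDef x (subset_closure hx)).isHermitian.apply i j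
    simpa using this.symm
  simp only [energyDensity, matForm]
  congr 1
  · rw [Finset.sum_comm]
    exact Finset.sum_congr rfl fun i _ => Finset.sum_congr rfl fun j _ => by rw [hs]; ring
  · ring

/-- `a(·,·)` as a continuous bilinear form on `V`. -/
def energyForm : P.V →L[ℝ] P.V →L[ℝ] ℝ :=
  LinearMap.mkContinuous₂
    (LinearMap.mk₂ ℝ P.a P.a_add_left P.a_smul_left
      (fun u v v' => by rw [P.a_comm, P.a_add_left, P.a_comm v, P.a_comm v'])
      (fun c u v => by rw [P.a_comm, P.a_smul_left, P.a_comm v, smul_eq_mul]))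
    P.exists_bound.choose P.exists_bound.choose_spec

@[simp] theorem energyForm_apply (u v : P.V) : P.energyForm u v = P.a u v := rfl

theorem coercive : ∃ c : ℝ, 0 < c ∧ ∀ v : P.V, c * ‖v‖ * ‖v‖ ≤ P.a v v := by
  obtain ⟨α, hα, hell⟩ := P.exists_uniform_elliptic
  obtain ⟨C, hC, hpoin⟩ := poincare P.dim_pos P.isOpen P.isBounded
  refine ⟨α / (1 + C), by positivity, fun v => ?_⟩
  have h1 : α * ‖weakGrad P.Ω v‖ ^ 2 ≤ P.a v v := by
    have h2 : ‖weakGrad P.Ω v‖ ^ 2 = ∫ x in P.Ω, ‖weakGrad P.Ω v x‖ ^ 2 := by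
      rw [← real_inner_self_eq_norm_sq, L2.inner_def]
      simp only [real_inner_self_eq_norm_sq]
    rw [h2, ← integral_const_mul]
    refine integral_mono_ae ?_ (P.integrable_energyDensity v v) ?_
    · have := (integral_norm_mul_norm_le (weakGrad P.Ω v) (weakGrad P.Ω v)).1
      simpa [sq] using this.const_mul α
    · filter_upwards [P.φ_nonneg, ae_restrict_mem P.isOpen.measurableSet] with x hx hxm
      have := hell x hxm (weakGrad P.Ω v x)
      have h3 : 0 ≤ P.φ x * embL2 P.Ω v x * embL2 P.Ω v x := by
        rw [mul_assoc]; exact mul_nonneg hx (mul_self_nonneg _)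
      simp only [energyDensity]
      linarith
  have h4 := norm_sq_eq v
  have h5 := hpoin v
  have h6 : ‖v‖ ^ 2 ≤ (1 + C) * ‖weakGrad P.Ω v‖ ^ 2 := by nlinarith
  calc α / (1 + C) * ‖v‖ * ‖v‖ = α / (1 + C) * ‖v‖ ^ 2 := by ring
    _ ≤ α / (1 + C) * ((1 + C) * ‖weakGrad P.Ω v‖ ^ 2) := by gcongr
    _ = α * ‖weakGrad P.Ω v‖ ^ 2 := by field_simp
    _ ≤ _ := h1

/-- The variational problem on a closed subspace has a unique solution. -/
theorem exists_solution (W : Submodule ℝ P.V) [CompleteSpace W] (F : P.V →L[ℝ] ℝ) :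
    ∃ u ∈ W, ∀ v ∈ W, P.a u v = F v := by
  set B : W →L[ℝ] W →L[ℝ] ℝ := P.energyForm.bilinearComp W.subtypeL W.subtypeL
  have hB : IsCoercive B := by
    obtain ⟨c, hc, h⟩ := P.coercive
    exact ⟨c, hc, fun v => h v⟩
  obtain ⟨u, hu⟩ := hB.continuousLinearEquivOfBilin.surjective
    ((InnerProductSpace.toDual ℝ W).symm (F.comp W.subtypeL))
  refine ⟨u, u.2, fun v hv => ?_⟩
  have h1 := hB.continuousLinearEquivOfBilin_apply u ⟨v, hv⟩
  rw [hu, InnerProductSpace.toDual_symm_apply] at h1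
  exact h1.symm

/-- The unique `u ∈ W` with `a(u,v) = F(v)` for all `v ∈ W`. -/
def solve (W : Submodule ℝ P.V) [CompleteSpace W] (F : P.V →L[ℝ] ℝ) : P.V :=
  (P.exists_solution W F).choose

theorem solve_mem (W : Submodule ℝ P.V) [CompleteSpace W] (F : P.V →L[ℝ] ℝ) :
    P.solve W F ∈ W := (P.exists_solution W F).choose_spec.1

theorem a_solve (W : Submodule ℝ P.V) [CompleteSpace W] (F : P.V →L[ℝ] ℝ) (v : P.V)
    (hv : v ∈ W) : P.a (P.solve W F) v = F v := (P.exists_solution W F).choose_spec.2 v hv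

theorem eq_solve (W : Submodule ℝ P.V) [CompleteSpace W] (F : P.V →L[ℝ] ℝ) (u : P.V)
    (hu : u ∈ W) (h : ∀ v ∈ W, P.a u v = F v) : u = P.solve W F := by
  obtain ⟨c, hc, hco⟩ := P.coercive
  set e := u - P.solve W F with he
  have heW : e ∈ W := W.sub_mem hu (P.solve_mem W F)
  have h0 : P.a e e = 0 := by
    have h1 : P.a e e = P.a u e - P.a (P.solve W F) e := by
      have h2 : u = e + P.solve W F := by rw [he]; abel
      have h3 := P.a_add_left e (P.solve W F) e
      rw [← h2] at h3
      linarith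
    rw [h1, h e heW, P.a_solve W F e heW, sub_self]
  have h2 := hco e
  rw [h0] at h2
  have h3 : ‖e‖ = 0 := by
    by_contra hne
    have : 0 < ‖e‖ := lt_of_le_of_ne (norm_nonneg _) (Ne.symm hne)
    have : 0 < c * ‖e‖ * ‖e‖ := by positivity
    linarith
  exact sub_eq_zero.1 (norm_eq_zero.1 h3)

/-- The functional `v ↦ (f, v)`. -/
def load (f : L2 P.Ω) : P.V →L[ℝ] ℝ := (innerSL ℝ f).comp (embL2 P.Ω)

/-- The `L²(Ω)` inner product `(u, v)` of two elements of `V`. -/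
def l2 (u v : P.V) : ℝ := inner ℝ (embL2 P.Ω u) (embL2 P.Ω v)

instance : CompleteSpace (⊤ : Submodule ℝ P.V) :=
  IsClosed.completeSpace_coe (s := ((⊤ : Submodule ℝ P.V) : Set P.V)) (hs := isClosed_univ)

/-- The solution operator: `a(Kf, v) = (f, v)` for all `v ∈ V`. -/
def K (f : L2 P.Ω) : P.V := P.solve ⊤ (P.load f)

/-- The projection onto a closed subspace with respect to `a`: `a(v - proj v, w) = 0`, `w ∈ W`. -/
def proj (W : Submodule ℝ P.V) [CompleteSpace W] (v : P.V) : P.V := P.solve W (P.energyForm v)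

/-- `lam` is an eigenvalue of the variational eigenvalue problem. -/
def IsEigenvalue (lam : ℝ) : Prop := ∃ u : P.V, u ≠ 0 ∧ ∀ v : P.V, P.a u v = lam * P.l2 u v

/-- The first (smallest) eigenvalue. -/
def firstEigenvalue : ℝ := sInf {lam : ℝ | P.IsEigenvalue lam}

/-- `M(lam)`, the eigenfunctions corresponding to `lam`, together with `0`. -/
def eigenspace (lam : ℝ) : Submodule ℝ P.V where
  carrier := {u | ∀ v : P.V, P.a u v = lam * P.l2 u v}
  zero_mem' := fun v => by
    rw [← P.energyForm_apply]; simp [l2]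
  add_mem' := fun {u u'} hu hu' v => by
    rw [P.a_add_left, hu v, hu' v, l2, l2, l2, map_add, inner_add_left]; ring
  smul_mem' := fun c u hu v => by
    rw [P.a_smul_left, hu v, l2, l2, map_smul, real_inner_smul_left]; ring

instance (lam : ℝ) : CompleteSpace (P.eigenspace lam) := by
  have h : IsClosed (P.eigenspace lam : Set P.V) := by
    have h1 : (P.eigenspace lam : Set P.V) =
        ⋂ v : P.V, {u : P.V | P.energyForm u v = lam * P.l2 u v} := by
      ext u; simp only [mem_iInter]; rfl
    rw [h1]
    refine isClosed_iInter fun v => isClosed_eq ?_ ?_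
    · exact P.energyForm.continuous.clm_apply continuous_const
    · exact continuous_const.mul ((embL2 P.Ω).continuous.inner continuous_const)
  exact h.completeSpace_coe

/-- The spectral projection `E : V → M(λ¹)`, `λ¹` the first eigenvalue. -/
def E (v : P.V) : P.V := P.proj (P.eigenspace P.firstEigenvalue) v

end EllipticProblem

/-! ### Meshes and finite element spaces -/

open Classical in
/-- A conforming mesh of the closure of `Ω` by `d`-simplices, each given by its set of vertices. -/
structure Mesh {d : ℕ} (Ω : Set (Pt d)) where
  elements : Finset (Finset (Pt d))
  card_eq : ∀ T ∈ elements, T.card = d + 1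
  affineIndependent : ∀ T ∈ elements, AffineIndependent ℝ (fun x : T => (x : Pt d))
  conforming : ∀ S ∈ elements, ∀ T ∈ elements,
    convexHull ℝ (S : Set (Pt d)) ∩ convexHull ℝ (T : Set (Pt d)) =
      convexHull ℝ ((S ∩ T : Finset (Pt d)) : Set (Pt d))
  covers : ⋃ T ∈ elements, convexHull ℝ (T : Set (Pt d)) = closure Ω

/-- `𝒯'` is a refinement of `𝒯`. -/
def Mesh.IsRefinement {d : ℕ} {Ω : Set (Pt d)} (𝒯' 𝒯 : Mesh Ω) : Prop :=
  ∀ S ∈ 𝒯'.elements, ∃ T ∈ 𝒯.elements,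
    convexHull ℝ (S : Set (Pt d)) ⊆ convexHull ℝ (T : Set (Pt d))

open Classical in
/-- The interior faces: the common `(d-1)`-dimensional faces of two different elements. -/
def Mesh.interiorFaces {d : ℕ} {Ω : Set (Pt d)} (𝒯 : Mesh Ω) : Finset (Finset (Pt d)) :=
  (𝒯.elements.offDiag.image fun p => p.1 ∩ p.2).filter fun F => F.card = d

/-- The value of a polynomial at a point. -/
def polyEval {d : ℕ} (q : MvPolynomial (Fin d) ℝ) (x : Pt d) : ℝ :=
  MvPolynomial.eval (fun i => x i) q

/-- The gradient of a polynomial at a point. -/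
def polyGrad {d : ℕ} (q : MvPolynomial (Fin d) ℝ) (x : Pt d) : Pt d :=
  WithLp.toLp 2 fun i => polyEval (MvPolynomial.pderiv i q) x

/-- On every element, `p` is a polynomial of degree at most `m`. -/
def Mesh.IsPiecewisePoly {d : ℕ} {Ω : Set (Pt d)} (𝒯 : Mesh Ω) (m : ℕ) (p : Pt d → ℝ) : Prop :=
  ∀ T ∈ 𝒯.elements, ∃ q : MvPolynomial (Fin d) ℝ, q.totalDegree ≤ m ∧
    ∀ x ∈ convexHull ℝ (T : Set (Pt d)), p x = polyEval q x

namespace EllipticProblem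

variable {d : ℕ} (P : EllipticProblem d)

/-- The finite element space over `𝒯` of continuous piecewise polynomials of degree `m` which
vanish on the boundary of `Ω`. -/
def feSpace (𝒯 : Mesh P.Ω) (m : ℕ) : Submodule ℝ P.V where
  carrier := {v | ∃ p : Pt d → ℝ, ContinuousOn p (closure P.Ω) ∧ (∀ x ∈ frontier P.Ω, p x = 0) ∧
    𝒯.IsPiecewisePoly m p ∧ embL2 P.Ω v =ᵐ[volume.restrict P.Ω] p}
  zero_mem' := by
    refine ⟨fun _ => 0, continuousOn_const, fun _ _ => rfl,
      fun T _ => ⟨0, by simp, fun x _ => by simp [polyEval]⟩, ?_⟩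
    rw [map_zero]
    exact Lp.coeFn_zero _ _ _
  add_mem' := by
    rintro u v ⟨p, h1, h2, h3, h4⟩ ⟨r, g1, g2, g3, g4⟩
    refine ⟨fun x => p x + r x, h1.add g1, fun x hx => by simp [h2 x hx, g2 x hx],
      fun T hT => ?_, ?_⟩
    · obtain ⟨q, hq, hq'⟩ := h3 T hT
      obtain ⟨q', hr, hr'⟩ := g3 T hT
      exact ⟨q + q', (MvPolynomial.totalDegree_add _ _).trans (max_le hq hr),
        fun x hx => by simp [hq' x hx, hr' x hx, polyEval]⟩
    · rw [map_add]
      exact (Lp.coeFn_add _ _).trans (h4.add g4)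
  smul_mem' := by
    rintro c u ⟨p, h1, h2, h3, h4⟩
    refine ⟨fun x => c * p x, continuousOn_const.mul h1, fun x hx => by simp [h2 x hx],
      fun T hT => ?_, ?_⟩
    · obtain ⟨q, hq, hq'⟩ := h3 T hT
      exact ⟨c • q, (MvPolynomial.totalDegree_smul_le _ _).trans hq,
        fun x hx => by simp [hq' x hx, polyEval]⟩
    · rw [map_smul]
      exact (Lp.coeFn_smul _ _).trans (h4.const_smul c)

instance (𝒯 : Mesh P.Ω) (m : ℕ) : FiniteDimensional ℝ (P.feSpace 𝒯 m) := by
  classical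
  let Q := ∀ _ : 𝒯.elements, MvPolynomial.restrictTotalDegree (Fin d) ℝ m
  let Φ : Q → Pt d → ℝ := fun q x =>
    if h : ∃ T : 𝒯.elements, x ∈ convexHull ℝ ((T : Finset (Pt d)) : Set (Pt d)) then
      polyEval (q h.choose : MvPolynomial (Fin d) ℝ) x else 0
  have hΦadd : ∀ q q' : Q, Φ (q + q') = Φ q + Φ q' := by
    intro q q'; ext1 x
    by_cases h : ∃ T : 𝒯.elements, x ∈ convexHull ℝ ((T : Finset (Pt d)) : Set (Pt d))
    · simp only [Φ, Pi.add_apply, dif_pos h]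
      exact map_add (MvPolynomial.eval fun i => x i) _ _
    · simp only [Φ, Pi.add_apply, dif_neg h]; simp
  have hΦsmul : ∀ (c : ℝ) (q : Q), Φ (c • q) = c • Φ q := by
    intro c q; ext1 x
    by_cases h : ∃ T : 𝒯.elements, x ∈ convexHull ℝ ((T : Finset (Pt d)) : Set (Pt d))
    · simp only [Φ, Pi.smul_apply, dif_pos h]
      exact MvPolynomial.smul_eval _ _ _
    · simp only [Φ, Pi.smul_apply, dif_neg h]; simp
  let G : Submodule ℝ (Q × P.V) :=
    { carrier := {z | embL2 P.Ω z.2 =ᵐ[volume.restrict P.Ω] Φ z.1}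
      zero_mem' := by
        have : Φ 0 = 0 := by simpa using hΦsmul 0 0
        change embL2 P.Ω 0 =ᵐ[volume.restrict P.Ω] Φ 0
        rw [this, map_zero]
        exact Lp.coeFn_zero _ _ _
      add_mem' := by
        intro z z' (h : embL2 P.Ω z.2 =ᵐ[volume.restrict P.Ω] Φ z.1)
          (h' : embL2 P.Ω z'.2 =ᵐ[volume.restrict P.Ω] Φ z'.1)
        change embL2 P.Ω (z.2 + z'.2) =ᵐ[volume.restrict P.Ω] Φ (z.1 + z'.1)
        rw [hΦadd, map_add]
        exact (Lp.coeFn_add _ _).trans (h.add h')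
      smul_mem' := by
        intro c z (h : embL2 P.Ω z.2 =ᵐ[volume.restrict P.Ω] Φ z.1)
        change embL2 P.Ω (c • z.2) =ᵐ[volume.restrict P.Ω] Φ (c • z.1)
        rw [hΦsmul, map_smul]
        exact (Lp.coeFn_smul _ _).trans (h.const_smul c) }
  have hG : FiniteDimensional ℝ G := by
    refine FiniteDimensional.of_injective ((LinearMap.fst ℝ Q P.V).comp G.subtype) ?_
    rintro ⟨⟨q, v⟩, h⟩ ⟨⟨q', v'⟩, h'⟩ (e : q = q')
    subst e
    have h0 : embL2 P.Ω v =ᵐ[volume.restrict P.Ω] Φ q := h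
    have h0' : embL2 P.Ω v' =ᵐ[volume.restrict P.Ω] Φ q := h'
    have h1 : embL2 P.Ω v = embL2 P.Ω v' := Lp.ext (h0.trans h0'.symm)
    have h2 := embL2_injective P.isOpen h1
    subst h2; rfl
  refine Submodule.finiteDimensional_of_le (S₂ := G.map (LinearMap.snd ℝ Q P.V)) ?_
  rintro v ⟨p, -, -, h3, h4⟩
  choose q hq hq' using h3
  let q₀ : Q := fun T => ⟨q T T.2, (MvPolynomial.mem_restrictTotalDegree _ _ _).2 (hq T T.2)⟩
  refine ⟨(q₀, v), ?_, rfl⟩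
  change embL2 P.Ω v =ᵐ[volume.restrict P.Ω] Φ q₀
  filter_upwards [h4, ae_restrict_mem P.isOpen.measurableSet] with x hx hxΩ
  have hex : ∃ T : 𝒯.elements, x ∈ convexHull ℝ ((T : Finset (Pt d)) : Set (Pt d)) := by
    have := subset_closure hxΩ
    rw [← 𝒯.covers] at this
    simpa using this
  rw [hx, hq' _ hex.choose.2 x hex.choose_spec]
  simp only [Φ, dif_pos hex, q₀]

/-- The Galerkin projection onto the finite element space over `𝒯`. -/
def R (𝒯 : Mesh P.Ω) (m : ℕ) (v : P.V) : P.V := P.proj (P.feSpace 𝒯 m) v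

/-! ### The a posteriori error estimator -/

open Classical in
/-- The polynomial that represents `v` on the element `T`. -/
def localPoly (v : P.V) (T : Finset (Pt d)) : MvPolynomial (Fin d) ℝ :=
  if h : ∃ q : MvPolynomial (Fin d) ℝ,
    embL2 P.Ω v =ᵐ[volume.restrict (convexHull ℝ (T : Set (Pt d)) ∩ P.Ω)] polyEval q
  then h.choose else 0

/-- The element residual `f - Lv = f + ∇·(A∇v) - φv` in `T`. -/
def elementResidual (f : L2 P.Ω) (v : P.V) (T : Finset (Pt d)) (x : Pt d) : ℝ :=
  f x + (∑ i, ∑ j,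
      (weakPartial P.Ω i (fun y => P.A y i j) x *
          polyEval (MvPolynomial.pderiv j (P.localPoly v T)) x +
        P.A x i j * polyEval (MvPolynomial.pderiv i (MvPolynomial.pderiv j (P.localPoly v T))) x))
    - P.φ x * polyEval (P.localPoly v T) x

open Classical in
/-- The unit outward normal of the simplex `T` on its face `F`. -/
def outwardNormal (T F : Finset (Pt d)) : Pt d :=
  if h : ∃ ν : Pt d, ‖ν‖ = 1 ∧ (∀ x ∈ F, ∀ y ∈ F, inner ℝ ν (x - y) = 0) ∧
    ∀ x ∈ T, ∀ y ∈ F, inner ℝ ν (x - y) ≤ 0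
  then h.choose else 0

open Classical in
/-- The jump residual `-A∇v⁺·ν⁺ - A∇v⁻·ν⁻` on an interior face `F`; the sum is over the two
elements of the mesh that have the face `F`. -/
def jumpResidual (𝒯 : Mesh P.Ω) (v : P.V) (F : Finset (Pt d)) (x : Pt d) : ℝ :=
  -∑ T ∈ 𝒯.elements.filter (fun T => F ⊆ T),
    matForm (P.A x) (polyGrad (P.localPoly v T) x) (outwardNormal T F)

/-- `h_T`, the diameter of an element. -/
def elementSize (T : Finset (Pt d)) : ℝ := Metric.diam (convexHull ℝ (T : Set (Pt d)))

/-- `h_E`, the diameter of a face `F` of `T`; in one dimension, where faces are points, it is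
replaced by `h_T`. -/
def faceSize (T F : Finset (Pt d)) : ℝ :=
  if d = 1 then elementSize T else Metric.diam (convexHull ℝ (F : Set (Pt d)))

open Classical in
/-- The square `η²(f,v;T)` of the local error indicator. -/
def indicatorSq (𝒯 : Mesh P.Ω) (f : L2 P.Ω) (v : P.V) (T : Finset (Pt d)) : ℝ :=
  elementSize T ^ 2 *
      (∫ x in convexHull ℝ (T : Set (Pt d)) ∩ P.Ω, P.elementResidual f v T x ^ 2) +
    ∑ F ∈ 𝒯.interiorFaces.filter (fun F => F ⊆ T), faceSize T F *
      ∫ x in convexHull ℝ (F : Set (Pt d)), P.jumpResidual 𝒯 v F x ^ 2 ∂(μHE[d - 1])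

/-- The error estimator `η(f,v;𝒮)` on a set `𝒮` of elements of `𝒯`. -/
def estimator (𝒯 : Mesh P.Ω) (f : L2 P.Ω) (v : P.V) (𝒮 : Finset (Finset (Pt d))) : ℝ :=
  Real.sqrt (∑ T ∈ 𝒮, P.indicatorSq 𝒯 f v T)

/-! ### The modules of the algorithm -/

/-- `(μ, w) = ESOLVE(W)`: `(μ, w)` is a discrete eigenpair in `W` for the smallest discrete
eigenvalue, normalized by `‖w‖_a = 1`. -/
def IsESolve (W : Submodule ℝ P.V) (μ : ℝ) (w : P.V) : Prop :=
  w ∈ W ∧ P.energyNorm w = 1 ∧ (∀ v ∈ W, P.a w v = μ * P.l2 w v) ∧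
    ∀ (μ' : ℝ) (w' : P.V), w' ∈ W → w' ≠ 0 → (∀ v ∈ W, P.a w' v = μ' * P.l2 w' v) → μ ≤ μ'

/-- `LSOLVE(f, W)`: the unique `w ∈ W` with `a(w,v) = (f,v)` for all `v ∈ W`. -/
def lsolve (f : L2 P.Ω) (W : Submodule ℝ P.V) [CompleteSpace W] : P.V := P.solve W (P.load f)

/-- `ℳ = MARK(θ, η(f,v;·), 𝒯)`: a minimal subset of `𝒯` with `η(f,v;ℳ) ≥ θ η(f,v;𝒯)`. -/
def IsMark (θ : ℝ) (𝒯 : Mesh P.Ω) (f : L2 P.Ω) (v : P.V) (ℳ : Finset (Finset (Pt d))) : Prop :=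
  Minimal (fun 𝒮 => 𝒮 ⊆ 𝒯.elements ∧
    θ * P.estimator 𝒯 f v 𝒯.elements ≤ P.estimator 𝒯 f v 𝒮) ℳ

end EllipticProblem

/-- `𝒯' = REFINE(ℳ, 𝒯)`: a conforming refinement in which at least all elements of `ℳ` are
refined. -/
def IsRefine {d : ℕ} {Ω : Set (Pt d)} (ℳ : Finset (Finset (Pt d))) (𝒯 𝒯' : Mesh Ω) : Prop :=
  𝒯'.IsRefinement 𝒯 ∧ ∀ T ∈ ℳ, T ∉ 𝒯'.elements

/-! ### The adaptive algorithm -/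

/-- The input of the algorithm: the polynomial degree, the two parameters and the coarse mesh. -/
structure Input {d : ℕ} (P : EllipticProblem d) where
  m : ℕ
  one_le_m : 1 ≤ m
  θ₁ : ℝ
  θ₁_mem : θ₁ ∈ Set.Ioo (0 : ℝ) 1
  θ₂ : ℝ
  θ₂_mem : θ₂ ∈ Set.Ioo (0 : ℝ) 1
  coarse : Mesh P.Ω

/-- The data of the algorithm when the linear problem for the iterate `(k, j)` is to be solved. -/
structure Iterate {d : ℕ} (P : EllipticProblem d) where
  k : ℕ
  j : ℕ
  ℓ : ℕ
  /-- the index `n_ℓ` -/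
  n : ℕ
  /-- the mesh `𝒯_k` -/
  mesh : Mesh P.Ω
  /-- the right hand side `f̄_k^{(j)}` -/
  fbar : P.V
  /-- the reference estimate `η_ℓ` -/
  η : ℝ

/-- The data of the algorithm when the work on the mesh `𝒯_k` is finished. -/
structure Level {d : ℕ} (P : EllipticProblem d) where
  k : ℕ
  ℓ : ℕ
  /-- the index `n_ℓ` -/
  n : ℕ
  /-- the mesh `𝒯_k` -/
  mesh : Mesh P.Ω
  /-- the right hand side `f̄_k` -/
  fbar : P.V
  /-- the solution `ū_k` of the linear problem -/
  ubar : P.V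
  /-- the eigenfunction approximation `u_k` -/
  u : P.V
  /-- the eigenvalue approximation `λ_k` -/
  lam : ℝ
  /-- the next right hand side `f̄_{k+1}^{(0)}` -/
  next : P.V
  /-- the reference estimate `η_ℓ` -/
  η : ℝ

namespace Input

variable {d : ℕ} {P : EllipticProblem d} (I : Input P)

/-- The finite element space over a mesh. -/
abbrev space (𝒯 : Mesh P.Ω) : Submodule ℝ P.V := P.feSpace 𝒯 I.m

/-- `V_H + span{u}`. -/
def enriched (u : P.V) : Submodule ℝ P.V := I.space I.coarse ⊔ Submodule.span ℝ {u}

/-- `ū_k^{(j)} = LSOLVE(f̄_k^{(j)}, V_k)`. -/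
def ubar (s : Iterate P) : P.V := P.lsolve (embL2 P.Ω s.fbar) (I.space s.mesh)

/-- `u_k^{(j)} = ū_k^{(j)} / ‖ū_k^{(j)}‖_a`. -/
def u (s : Iterate P) : P.V := (P.energyNorm (I.ubar s))⁻¹ • I.ubar s

/-- `λ_k^{(j)} = a(u_k^{(j)}, u_k^{(j)}) / (u_k^{(j)}, u_k^{(j)})`. -/
def lam (s : Iterate P) : ℝ := P.a (I.u s) (I.u s) / P.l2 (I.u s) (I.u s)

/-- `η_k(f̄_k^{(j)}, ū_k^{(j)}; 𝒯_k)`. -/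
def est (s : Iterate P) : ℝ :=
  P.estimator s.mesh (embL2 P.Ω s.fbar) (I.ubar s) s.mesh.elements

/-- The decision condition `η_k(f̄_k^{(j)}, ū_k^{(j)}; 𝒯_k) ≤ θ₂^{j+1} η_ℓ`. -/
def Repeats (s : Iterate P) : Prop := I.est s ≤ I.θ₂ ^ (s.j + 1) * s.η

/-- The first level: an eigenvalue problem is solved over a refinement of the coarse mesh. -/
def firstLevel (𝒯₁ : Mesh P.Ω) (lam₁ : ℝ) (u₁ : P.V) : Level P where
  k := 1
  ℓ := 1
  n := 1
  mesh := 𝒯₁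
  fbar := u₁
  ubar := lam₁⁻¹ • u₁
  u := u₁
  lam := lam₁
  next := u₁
  η := P.estimator 𝒯₁ (embL2 P.Ω u₁) (lam₁⁻¹ • u₁) 𝒯₁.elements

/-- The beginning of the work on the next mesh. -/
def startIterate (L : Level P) (𝒯' : Mesh P.Ω) : Iterate P where
  k := L.k + 1
  j := 0
  ℓ := L.ℓ
  n := L.n
  mesh := 𝒯'
  fbar := L.next
  η := L.η

/-- The end of the work on a mesh after one linear solve (`j = 0`). -/
def finishZero (s : Iterate P) : Level P where
  k := s.k
  ℓ := s.ℓ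
  n := s.n
  mesh := s.mesh
  fbar := s.fbar
  ubar := I.ubar s
  u := I.u s
  lam := I.lam s
  next := I.u s
  η := s.η

/-- The end of the work on a mesh after more than one linear solve (`j > 0`); `v` is the result of
the eigenvalue problem in the enriched coarse space. -/
def finishPos (s : Iterate P) (v : P.V) : Level P where
  k := s.k
  ℓ := s.ℓ + 1
  n := s.k
  mesh := s.mesh
  fbar := s.fbar
  ubar := I.ubar s
  u := I.u s
  lam := I.lam s
  next := v
  η := I.est s

mutual

/-- The iterates that are reached in some run of the algorithm. -/
inductive ProducesIterate : Iterate P → Prop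
  /-- MARK and REFINE on a finished level -/
  | start (L : Level P) (ℳ : Finset (Finset (Pt d))) (𝒯' : Mesh P.Ω) :
      ProducesLevel L →
      P.IsMark I.θ₁ L.mesh (embL2 P.Ω L.fbar) L.ubar ℳ →
      IsRefine ℳ L.mesh 𝒯' →
      ProducesIterate (startIterate L 𝒯')
  /-- the decision condition holds: correct the right hand side and repeat on the same mesh -/
  | again (s : Iterate P) (μ : ℝ) (v : P.V) :
      ProducesIterate s → I.Repeats s → P.IsESolve (I.enriched (I.u s)) μ v →
      ProducesIterate { s with j := s.j + 1, fbar := v }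

/-- The finished levels that are reached in some run of the algorithm. -/
inductive ProducesLevel : Level P → Prop
  | first (𝒯₁ : Mesh P.Ω) (lam₁ : ℝ) (u₁ : P.V) :
      𝒯₁.IsRefinement I.coarse → P.IsESolve (I.space 𝒯₁) lam₁ u₁ →
      ProducesLevel (firstLevel 𝒯₁ lam₁ u₁)
  | finishZero (s : Iterate P) :
      ProducesIterate s → ¬ I.Repeats s → s.j = 0 →
      ProducesLevel (I.finishZero s)
  | finishPos (s : Iterate P) (μ : ℝ) (v : P.V) :
      ProducesIterate s → ¬ I.Repeats s → 0 < s.j → P.IsESolve (I.enriched (I.u s)) μ v →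
      ProducesLevel (I.finishPos s v)

end

end Input

/-- The normalized right hand side `f = f̄ / ‖K f̄‖_a`. -/
def EllipticProblem.normalizedSource {d : ℕ} (P : EllipticProblem d) (fbar : P.V) : L2 P.Ω :=
  (P.energyNorm (P.K (embL2 P.Ω fbar)))⁻¹ • embL2 P.Ω fbar

/-- `w = K f` with `f = f̄ / ‖K f̄‖_a`. -/
def EllipticProblem.w {d : ℕ} (P : EllipticProblem d) (fbar : P.V) : P.V :=
  P.K (P.normalizedSource fbar)

end AFEM

end

-- Everything takes place in `V` with the inner product `a`, whose definiteness comes from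
-- coercivity. By linearity of `K`, the function w is K f̄ / ‖K f̄‖_a, a unit vector in the energy
-- norm if K f̄ ≠ 0. A Galerkin solution is the `a`-orthogonal projection of the exact solution, so
-- R_k w = ū / ‖K f̄‖_a = c u, where u is the normalized discrete solution and c = ‖ū‖_a / ‖K f̄‖_a
-- (`smul_lsolve_eq_proj`).
--
-- The core is a fact about two unit vectors u, w of an inner product space such that c u is an
-- orthogonal projection of w (`energyNorm_sub_proj_normalized_proj_le`). Since ‖u‖ = ‖w‖ = 1, the
-- expansion of ‖u - c w‖² is symmetric in u and w, hence ‖u - c w‖ = ‖w - c u‖ = ‖(I - R_k) w‖; and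
-- |c| ≤ 1 because a projection does not increase the norm. As c Ew lies in the range of E, best
-- approximation gives ‖u - Eu‖ ≤ ‖u - c Ew‖ ≤ ‖u - c w‖ + |c| ‖w - Ew‖, which is the claim. E
-- enters as the `a`-orthogonal projection onto a complete subspace M.
--
-- The estimate concerns one linear solve, so no induction along the run is needed. The first level
-- is the only one whose function comes from an eigenvalue solve; `IsESolve.eq_normalized_lsolve`
-- recognizes it as a normalized linear solve with itself as right-hand side.

namespace AFEM

namespace EllipticProblem

variable {d : ℕ} (P : EllipticProblem d)

-- The energy inner product and its norm

theorem a_add_right (u v v' : P.V) : P.a u (v + v') = P.a u v + P.a u v' := by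
  rw [P.a_comm, P.a_add_left, P.a_comm v, P.a_comm v']

theorem a_smul_right (c : ℝ) (u v : P.V) : P.a u (c • v) = c * P.a u v := by
  rw [P.a_comm, P.a_smul_left, P.a_comm v]

theorem a_sub_left (u u' v : P.V) : P.a (u - u') v = P.a u v - P.a u' v := by
  have h := P.a_add_left (u - u') u' v
  rw [sub_add_cancel] at h
  linarith

theorem a_sub_right (u v v' : P.V) : P.a u (v - v') = P.a u v - P.a u v' := by
  rw [P.a_comm, P.a_sub_left, P.a_comm v, P.a_comm v']

theorem a_self_nonneg (v : P.V) : 0 ≤ P.a v v := by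
  obtain ⟨c, hc, h⟩ := P.coercive
  exact le_trans (by positivity) (h v)

/-- Coercivity makes `a` definite; this is what permits division by energy norms of nonzero vectors.
-/
theorem a_self_pos {v : P.V} (hv : v ≠ 0) : 0 < P.a v v := by
  obtain ⟨c, hc, h⟩ := P.coercive
  have : 0 < ‖v‖ := norm_pos_iff.2 hv
  exact lt_of_lt_of_le (by positivity) (h v)

theorem energyNorm_nonneg (v : P.V) : 0 ≤ P.energyNorm v := Real.sqrt_nonneg _

theorem energyNorm_sq (v : P.V) : P.energyNorm v ^ 2 = P.a v v :=
  Real.sq_sqrt (P.a_self_nonneg v)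

theorem energyNorm_pos {v : P.V} (hv : v ≠ 0) : 0 < P.energyNorm v :=
  Real.sqrt_pos.2 (P.a_self_pos hv)

theorem energyNorm_smul (c : ℝ) (v : P.V) : P.energyNorm (c • v) = |c| * P.energyNorm v := by
  rw [energyNorm, P.a_smul_left, P.a_smul_right, ← mul_assoc, ← sq, Real.sqrt_mul (sq_nonneg c),
    Real.sqrt_sq_eq_abs, energyNorm]

/-- Cauchy-Schwarz inequality for the energy inner product. -/
theorem a_le_energyNorm_mul (u v : P.V) : P.a u v ≤ P.energyNorm u * P.energyNorm v := by
  by_cases hv : v = 0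
  · have h : ∀ w : P.V, P.a w 0 = 0 := fun w => by simpa using P.a_smul_right 0 w 0
    simp [hv, h, energyNorm]
  have hpos := P.a_self_pos hv
  -- The vector is a(v,v) times the component of u orthogonal to v. Its square expands to a(v,v)
  -- (a(u,u) a(v,v) - a(u,v)²), and the positive factor a(v,v) is then cancelled.
  have h := P.a_self_nonneg (P.a v v • u - P.a u v • v)
  simp only [a_sub_left, a_sub_right, a_smul_left, a_smul_right, P.a_comm v u] at h
  have h1 : 0 ≤ P.a v v * (P.a u u * P.a v v - P.a u v ^ 2) := by linarith
  have h2 := nonneg_of_mul_nonneg_right h1 hpos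
  refine le_of_sq_le_sq ?_ (mul_nonneg (P.energyNorm_nonneg u) (P.energyNorm_nonneg v))
  rw [mul_pow, energyNorm_sq, energyNorm_sq]
  linarith

theorem energyNorm_add_le (u v : P.V) :
    P.energyNorm (u + v) ≤ P.energyNorm u + P.energyNorm v := by
  refine le_of_sq_le_sq ?_ (add_nonneg (P.energyNorm_nonneg u) (P.energyNorm_nonneg v))
  have h := P.a_le_energyNorm_mul u v
  rw [energyNorm_sq, add_sq, energyNorm_sq, energyNorm_sq, a_add_left, a_add_right, a_add_right,
    P.a_comm v u]
  linarith

-- Projections orthogonal with respect to the energy form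

section Projection

variable (W : Submodule ℝ P.V) [CompleteSpace W]

theorem proj_mem (v : P.V) : P.proj W v ∈ W := P.solve_mem W _

theorem a_proj (v : P.V) {w : P.V} (hw : w ∈ W) : P.a (P.proj W v) w = P.a v w :=
  P.a_solve W _ w hw

/-- The `a`-orthogonal projection is the best approximation in the energy norm. -/
theorem energyNorm_sub_proj_le (v : P.V) {w : P.V} (hw : w ∈ W) :
    P.energyNorm (v - P.proj W v) ≤ P.energyNorm (v - w) := by
  refine Real.sqrt_le_sqrt ?_
  -- Pythagoras: by the two orthogonality relations, ‖v - w‖² - ‖v - Pv‖² = ‖Pv - w‖², where P is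
  -- the projection; `h3` says that this is nonnegative.
  have h1 := P.a_proj W v (P.proj_mem W v)
  have h2 := P.a_proj W v hw
  have h3 := P.a_self_nonneg (P.proj W v - w)
  simp only [a_sub_left, a_sub_right, P.a_comm w, P.a_comm (P.proj W v) v] at h1 h2 h3 ⊢
  linarith

/-- The Galerkin solution is the projection of the exact solution. -/
theorem smul_lsolve_eq_proj (c : ℝ) (f : L2 P.Ω) :
    c • P.lsolve f W = P.proj W (P.K (c • f)) := by
  -- Both sides lie in `W` and represent the functional v ↦ c (f, v) there, so uniqueness of the
  -- variational solution identifies them.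
  refine P.eq_solve W _ _ (W.smul_mem c (P.solve_mem W _)) fun v hv => ?_
  rw [P.a_smul_left, lsolve, P.a_solve W _ v hv, energyForm_apply, K,
    P.a_solve ⊤ _ v Submodule.mem_top]
  simp [load]

end Projection

-- Normalized Galerkin solutions and their distance to a subspace

theorem K_smul (c : ℝ) (f : L2 P.Ω) : P.K (c • f) = c • P.K f := by
  refine (P.eq_solve ⊤ _ _ Submodule.mem_top fun v hv => ?_).symm
  rw [P.a_smul_left, K, P.a_solve ⊤ _ v hv]
  simp [load]

/-- For unit vectors, u and w may be interchanged in ‖w - c u‖. This turns the projection error of w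
into the distance from u to c w, after which c times the projection of w onto `M` serves as a
competitor for u. -/
theorem energyNorm_sub_proj_normalized_proj_le (W M : Submodule ℝ P.V) [CompleteSpace W]
    [CompleteSpace M] {w u : P.V} (hw : P.energyNorm w = 1) (hu : P.energyNorm u = 1)
    {c : ℝ} (hc : P.proj W w = c • u) :
    P.energyNorm (u - P.proj M u) ≤
      P.energyNorm (w - P.proj W w) + P.energyNorm (w - P.proj M w) := by
  have hww : P.a w w = 1 := by rw [← energyNorm_sq, hw, one_pow]
  have huu : P.a u u = 1 := by rw [← energyNorm_sq, hu, one_pow]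
  -- The projection c u is orthogonal to w - c u. The factor c is kept, since c = 0 is possible;
  -- only c a(u,w) = c² is needed below.
  have hself : c * (P.a u w - c) = 0 := by
    have h := P.a_proj W w (P.proj_mem W w)
    rw [hc, a_smul_left, a_smul_right, a_smul_right, huu, P.a_comm w u] at h
    linarith
  have h1 : P.a (w - P.proj W w) (w - P.proj W w) = 1 - c ^ 2 := by
    rw [hc]
    simp only [a_sub_left, a_sub_right, a_smul_left, a_smul_right, hww, huu, P.a_comm w u]
    linarith
  -- The squared projection error 1 - c² is nonnegative.
  have h2 : |c| ≤ 1 := by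
    rw [← sq_le_one_iff_abs_le_one]
    linarith [P.a_self_nonneg (w - P.proj W w)]
  -- Both squares equal 1 - 2c a(u,w) + c² = 1 - c².
  have h3 : P.energyNorm (u - c • w) = P.energyNorm (w - P.proj W w) := by
    rw [energyNorm, energyNorm, h1]
    congr 1
    simp only [a_sub_left, a_sub_right, a_smul_left, a_smul_right, hww, huu, P.a_comm w u]
    linarith
  -- Testing best approximation with c times the projection of w avoids any appeal to linearity of
  -- the projection onto `M`.
  calc P.energyNorm (u - P.proj M u) ≤ P.energyNorm (u - c • P.proj M w) :=
        P.energyNorm_sub_proj_le M u (M.smul_mem c (P.proj_mem M w))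
    _ = P.energyNorm ((u - c • w) + c • (w - P.proj M w)) := by rw [smul_sub]; congr 1; abel
    _ ≤ P.energyNorm (u - c • w) + P.energyNorm (c • (w - P.proj M w)) :=
        P.energyNorm_add_le _ _
    _ ≤ _ := by
        rw [h3, energyNorm_smul]
        gcongr
        exact mul_le_of_le_one_left (P.energyNorm_nonneg _) h2

/-- The distance of the normalized Galerkin solution with right hand side `fbar` to a closed
subspace `M`. -/
theorem energyNorm_sub_proj_normalized_lsolve_le (W M : Submodule ℝ P.V) [CompleteSpace W]
    [CompleteSpace M] (fbar : P.V) {u : P.V}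
    (hu : u = (P.energyNorm (P.lsolve (embL2 P.Ω fbar) W))⁻¹ • P.lsolve (embL2 P.Ω fbar) W) :
    P.energyNorm (u - P.proj M u) ≤
      P.energyNorm (P.w fbar - P.proj W (P.w fbar)) +
        P.energyNorm (P.w fbar - P.proj M (P.w fbar)) := by
  set ubar := P.lsolve (embL2 P.Ω fbar) W with hubar
  set z := P.K (embL2 P.Ω fbar) with hz
  have hproj : P.proj W (P.w fbar) = (P.energyNorm z)⁻¹ • ubar :=
    (P.smul_lsolve_eq_proj W _ _).symm
  -- In the degenerate case the normalization yields u = 0, so the left side vanishes (compare with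
  -- the competitor 0) while the right side is nonnegative. Nothing has to be known about `fbar`.
  by_cases h0 : ubar = 0
  · have h := P.energyNorm_sub_proj_le M u M.zero_mem
    have hu0 : u = 0 := by rw [hu, h0, smul_zero]
    have h00 : P.energyNorm (0 : P.V) = 0 := by simpa using P.energyNorm_smul 0 0
    rw [sub_zero, hu0, h00] at h
    rw [hu0]
    exact h.trans (add_nonneg (P.energyNorm_nonneg _) (P.energyNorm_nonneg _))
  have hub := P.energyNorm_pos h0
  -- `ubar` is the projection of z onto `W`, so z = 0 would force `ubar` to vanish. Hence z can be
  -- normalized and `P.w fbar` is a unit vector.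
  have hz0 : z ≠ 0 := by
    intro h
    have h1 := P.smul_lsolve_eq_proj W 1 (embL2 P.Ω fbar)
    rw [one_smul, one_smul, ← hubar, ← hz, h] at h1
    refine h0 (h1.trans ?_)
    refine (P.eq_solve W _ _ W.zero_mem fun v _ => ?_).symm
    rw [energyForm_apply]
  have hzp := P.energyNorm_pos hz0
  -- The factor comes from `hproj` and from `ubar` being its own norm times u.
  refine P.energyNorm_sub_proj_normalized_proj_le W M
    (c := (P.energyNorm z)⁻¹ * P.energyNorm ubar) ?_ ?_ ?_
  · rw [w, normalizedSource, K_smul, energyNorm_smul, abs_of_pos (inv_pos.2 hzp),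
      inv_mul_cancel₀ hzp.ne']
  · rw [hu, energyNorm_smul, abs_of_pos (inv_pos.2 hub), inv_mul_cancel₀ hub.ne']
  · rw [hproj, hu, smul_smul, mul_assoc, mul_inv_cancel₀ hub.ne', mul_one]

-- Discrete eigenfunctions as normalized linear solves

/-- A normalized discrete eigenfunction is reproduced by a linear solve with itself as right hand
side, followed by normalization. -/
theorem IsESolve.eq_normalized_lsolve {P : EllipticProblem d} {W : Submodule ℝ P.V}
    [CompleteSpace W] {μ : ℝ} {u : P.V} (h : P.IsESolve W μ u) :
    u = (P.energyNorm (P.lsolve (embL2 P.Ω u) W))⁻¹ • P.lsolve (embL2 P.Ω u) W := by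
  obtain ⟨huW, hu1, heig, -⟩ := h
  -- Testing the eigenvalue equation with u itself gives 1 = μ (u,u) with (u,u) ≥ 0. The sign
  -- matters: for negative μ, normalizing u/μ would return -u.
  have hμ : 0 < μ := by
    have h1 : 1 = μ * P.l2 u u := by rw [← heig u huW, ← energyNorm_sq, hu1, one_pow]
    have h2 : 0 ≤ P.l2 u u := real_inner_self_nonneg
    exact pos_of_mul_pos_left (h1 ▸ one_pos) h2
  have hl : P.lsolve (embL2 P.Ω u) W = μ⁻¹ • u := by
    refine (P.eq_solve W _ _ (W.smul_mem _ huW) fun v hv => ?_).symm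
    rw [a_smul_left, heig v hv, inv_mul_cancel_left₀ hμ.ne']
    rfl
  rw [hl, energyNorm_smul, hu1, abs_of_pos (inv_pos.2 hμ), mul_one, inv_inv, smul_smul,
    mul_inv_cancel₀ hμ.ne', one_smul]

end EllipticProblem

end AFEM

-- Application to the iterates and levels of the algorithm

theorem mainTheorem5 {d : ℕ} (P : AFEM.EllipticProblem d) (I : AFEM.Input P) :
    (∀ s : AFEM.Iterate P, I.ProducesIterate s →
      P.energyNorm (I.u s - P.E (I.u s)) ≤
        P.energyNorm (P.w s.fbar - P.R s.mesh I.m (P.w s.fbar)) +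
          P.energyNorm (P.w s.fbar - P.E (P.w s.fbar))) ∧
    (∀ L : AFEM.Level P, I.ProducesLevel L →
      P.energyNorm (L.u - P.E L.u) ≤
        P.energyNorm (P.w L.fbar - P.R L.mesh I.m (P.w L.fbar)) +
          P.energyNorm (P.w L.fbar - P.E (P.w L.fbar))) := by
  -- `P.E` and `P.R` unfold to projections, and `I.u s` is by definition the normalized linear
  -- solve, hence `rfl`.
  have iterate : ∀ s : AFEM.Iterate P,
      P.energyNorm (I.u s - P.E (I.u s)) ≤
        P.energyNorm (P.w s.fbar - P.R s.mesh I.m (P.w s.fbar)) +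
          P.energyNorm (P.w s.fbar - P.E (P.w s.fbar)) := fun s =>
    P.energyNorm_sub_proj_normalized_lsolve_le (I.space s.mesh) _ s.fbar rfl
  refine ⟨fun s _ => iterate s, fun L hL => ?_⟩
  -- A level finished after linear solves inherits its function, right-hand side and mesh from the
  -- last iterate, so the bound carries over verbatim; on the first level the right-hand side is the
  -- eigenfunction itself.
  cases hL with
  | first 𝒯₁ lam₁ u₁ _ h =>
    exact P.energyNorm_sub_proj_normalized_lsolve_le (I.space 𝒯₁) _ u₁ h.eq_normalized_lsolve
  | finishZero s _ _ _ => exact iterate s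
  | finishPos s _ _ _ _ _ _ => exact iterate s
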